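/- Let $G$ be a discrete group that is amenable, i.e. there is a left invariant mean on $\ell^\infty(G)$: a continuous linear functional $m:\ell^\infty(G)\to\mathbb C$ with $\|m\|=m(1)=1$ and $m(f(g\,\cdot))=m(f)$ for all $g\in G$, $f\in\ell^\infty(G)$. Let $A$ be a $C^*$-algebra (not necessarily unital) that is commutative or finite-dimensional, and let $\alpha:G\to\mathrm{Aut}(A)$ be an action of $G$ on $A$ by $^*$-automorphisms. Let $\ell^1(G,A;\alpha)$ be the Banach algebra of all maps $a:G\to A$ with $\|a\|:=\sum_{g\in G}\|a_g\|<\infty$, with pointwise linear operations and the twisted convolution product $$(ab)_g=\sum_{k\in G}a_k\,\alpha_k(b_{k^{-1}g})\qquad(g\in G).$$ Then $\ell^1(G,A;\alpha)$ is an amenable Banach algebra. That is, writing $B=\ell^1(G,A;\alpha)$: for every Banach $B$-bimodule $E$ (a complex Banach space with commuting, bilinear, bounded left and right actions of $B$) and every bounded derivation $D:B\to E^*$, i.e. a bounded linear map with $D(ab)=a\cdot D(b)+D(a)\cdot b$ for all $a,b\in B$, there exists $x^*\in E^*$ such that $D(b)=b\cdot x^*-x^*\cdot b$ for all $b\in B$.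 Here $(b\cdot x^*)(x)=x^*(x\cdot b)$ and $(x^*\cdot b)(x)=x^*(b\cdot x)$ for $x\in E$. -/

import Mathlib

open scoped ENNReal

universe u v w

noncomputable section

/-! ### Amenable discrete groups -/

section AmenableGroup

variable {G : Type*} [Group G]

/-- The left translate `x ↦ f (g * x)` of a bounded function `f` on `G`. -/
def leftTranslate (g : G) (f : lp (fun _ : G => ℂ) ∞) : lp (fun _ : G => ℂ) ∞ :=
  ⟨fun x => f (g * x), by
    apply memℓp_infty
    refine ⟨‖f‖, ?_⟩
    rintro _ ⟨x, rfl⟩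
    exact lp.norm_apply_le_norm (by simp) f (g * x)⟩

/-- A left invariant mean on `ℓ^∞(G)`: a linear functional `m` with `‖m‖ = m(1) = 1` that is
invariant under left translations. -/
def IsLeftInvariantMean (m : lp (fun _ : G => ℂ) ∞ →L[ℂ] ℂ) : Prop :=
  ‖m‖ = 1 ∧ m 1 = 1 ∧ ∀ (g : G) (f : lp (fun _ : G => ℂ) ∞), m (leftTranslate g f) = m f

variable (G) in
/-- A discrete group is amenable if there is a left invariant mean on `ℓ^∞(G)`. -/
def IsAmenableGroup : Prop :=
  ∃ m : lp (fun _ : G => ℂ) ∞ →L[ℂ] ℂ, IsLeftInvariantMean m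

end AmenableGroup

/-! ### Amenable Banach algebras -/

section AmenableAlgebra

variable (B : Type*) [NonUnitalNormedRing B] [NormedSpace ℂ B]
  [IsScalarTower ℂ B B] [SMulCommClass ℂ B B]

/-- The structure of a Banach `B`-bimodule on `E`: commuting, jointly bounded, bilinear left and
right actions of `B` on `E`. -/
structure BanachBimodule (E : Type*) [NormedAddCommGroup E] [NormedSpace ℂ E] where
  /-- `lact b x` is `b · x`. -/
  lact : B →L[ℂ] E →L[ℂ] E
  /-- `ract b x` is `x · b`. -/
  ract : B →L[ℂ] E →L[ℂ] E
  lact_mul : ∀ (a b : B) (x : E), lact (a * b) x = lact a (lact b x)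
  ract_mul : ∀ (a b : B) (x : E), ract (a * b) x = ract b (ract a x)
  lact_ract : ∀ (a b : B) (x : E), ract b (lact a x) = lact a (ract b x)

namespace BanachBimodule

variable {B} {E : Type*} [NormedAddCommGroup E] [NormedSpace ℂ E] (M : BanachBimodule B E)

/-- The left action on the dual: `(b · φ)(x) = φ(x · b)`. -/
def dualLact (b : B) (φ : StrongDual ℂ E) : StrongDual ℂ E := φ.comp (M.ract b)

/-- The right action on the dual: `(φ · b)(x) = φ(b · x)`. -/
def dualRact (b : B) (φ : StrongDual ℂ E) : StrongDual ℂ E := φ.comp (M.lact b)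

/-- `D : B → E*` is a derivation: `D(ab) = a · D(b) + D(a) · b`. -/
def IsDerivation (D : B →L[ℂ] StrongDual ℂ E) : Prop :=
  ∀ a b : B, D (a * b) = M.dualLact a (D b) + M.dualRact b (D a)

/-- `D : B → E*` is inner: `D(b) = b · φ - φ · b` for some `φ ∈ E*`. -/
def IsInner (D : B →L[ℂ] StrongDual ℂ E) : Prop :=
  ∃ φ : StrongDual ℂ E, ∀ b : B, D b = M.dualLact b φ - M.dualRact b φ

end BanachBimodule

/-- A Banach algebra `B` is amenable if every bounded derivation of `B` into the dual of any
Banach `B`-bimodule (here: in an arbitrary universe `w`) is inner. -/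
def IsAmenableBanachAlgebra (B : Type u) [NonUnitalNormedRing B] [NormedSpace ℂ B]
    [IsScalarTower ℂ B B] [SMulCommClass ℂ B B] [CompleteSpace B] : Prop :=
  ∀ (E : Type w) [NormedAddCommGroup E] [NormedSpace ℂ E] [CompleteSpace E]
    (M : BanachBimodule B E) (D : B →L[ℂ] StrongDual ℂ E), M.IsDerivation D → M.IsInner D

end AmenableAlgebra

/-! ### The twisted convolution algebra -/

section TwistedL1

variable {G : Type*} [Group G] {A : Type*} [NonUnitalCStarAlgebra A]

/-- The underlying space of `ℓ¹(G, A; α)`: the maps `a : G → A` with `∑ g, ‖a g‖ < ∞`. The action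
`α` of `G` on `A` enters in the product below. -/
def TwistedL1 (_α : G →* (A ≃⋆ₐ[ℂ] A)) : Type _ := lp (fun _ : G => A) 1

namespace TwistedL1

variable (α : G →* (A ≃⋆ₐ[ℂ] A))

instance : NormedAddCommGroup (TwistedL1 α) :=
  inferInstanceAs (NormedAddCommGroup (lp (fun _ : G => A) 1))

instance : NormedSpace ℂ (TwistedL1 α) :=
  inferInstanceAs (NormedSpace ℂ (lp (fun _ : G => A) 1))

instance : CompleteSpace (TwistedL1 α) :=
  inferInstanceAs (CompleteSpace (lp (fun _ : G => A) 1))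

variable {α}

instance : CoeFun (TwistedL1 α) fun _ => G → A := ⟨fun a => a.1⟩

theorem ext {a b : TwistedL1 α} (h : ∀ g, a g = b g) : a = b := Subtype.ext (funext h)

theorem zero_apply (g : G) : (0 : TwistedL1 α) g = 0 := rfl

theorem add_apply (a b : TwistedL1 α) (g : G) : (a + b) g = a g + b g := rfl

theorem smul_apply (c : ℂ) (a : TwistedL1 α) (g : G) : (c • a) g = c • a g := rfl

theorem hasSum_norm (a : TwistedL1 α) : HasSum (fun g => ‖a g‖) ‖a‖ := by
  have h := lp.hasSum_norm (p := 1) (by simp) (show lp (fun _ : G => A) 1 from a)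
  simp only [ENNReal.toReal_one, Real.rpow_one] at h
  exact h

theorem summable_norm (a : TwistedL1 α) : Summable fun g => ‖a g‖ := a.hasSum_norm.summable

/-- The norm of `ℓ¹(G, A; α)`. -/
theorem norm_eq_tsum (a : TwistedL1 α) : ‖a‖ = ∑' g, ‖a g‖ := a.hasSum_norm.tsum_eq.symm

/-- An absolutely summable map, as an element of `ℓ¹(G, A; α)`. -/
def ofSummable (α : G →* (A ≃⋆ₐ[ℂ] A)) (f : G → A) (hf : Summable fun g => ‖f g‖) : TwistedL1 α :=
  ⟨f, memℓp_gen (by simpa using hf)⟩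

theorem norm_aut (k : G) (x : A) : ‖α k x‖ = ‖x‖ := StarAlgEquiv.norm_map (α k) x

theorem aut_mul (k l : G) (x : A) : α (k * l) x = α k (α l x) := by
  rw [map_mul]; rfl

theorem aut_tsum (k : G) {f : G → A} (hf : Summable f) : α k (∑' l, f l) = ∑' l, α k (f l) :=
  (hf.hasSum.map (α k) (StarAlgEquiv.isometry (α k)).continuous).tsum_eq.symm

/-- The reindexing `(g, k) ↦ (k, k⁻¹ * g)`. -/
def convEquiv (G : Type*) [Group G] : G × G ≃ G × G where
  toFun p := (p.2, p.2⁻¹ * p.1)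
  invFun p := (p.1 * p.2, p.1)
  left_inv p := by simp
  right_inv p := by simp

theorem summable_conv (a b : TwistedL1 α) :
    Summable fun p : G × G => ‖a p.2‖ * ‖b (p.2⁻¹ * p.1)‖ :=
  (convEquiv G).summable_iff.mpr
    (a.summable_norm.mul_of_nonneg b.summable_norm (fun _ => norm_nonneg _)
      (fun _ => norm_nonneg _))

theorem tsum_conv (a b : TwistedL1 α) :
    ∑' p : G × G, ‖a p.2‖ * ‖b (p.2⁻¹ * p.1)‖ = ‖a‖ * ‖b‖ := by
  rw [a.norm_eq_tsum, b.norm_eq_tsum, a.summable_norm.tsum_mul_tsum b.summable_norm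
    (a.summable_norm.mul_of_nonneg b.summable_norm (fun _ => norm_nonneg _)
      (fun _ => norm_nonneg _))]
  exact (convEquiv G).tsum_eq (fun p : G × G => ‖a p.1‖ * ‖b p.2‖)

theorem norm_term_le (a b : TwistedL1 α) (g k : G) :
    ‖a k * α k (b (k⁻¹ * g))‖ ≤ ‖a k‖ * ‖b (k⁻¹ * g)‖ :=
  (norm_mul_le _ _).trans_eq (by rw [norm_aut])

theorem summable_norm_term (a b : TwistedL1 α) (g : G) :
    Summable fun k => ‖a k * α k (b (k⁻¹ * g))‖ :=
  Summable.of_nonneg_of_le (fun _ => norm_nonneg _) (norm_term_le a b g)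
    ((summable_conv a b).prod_factor g)

theorem summable_term (a b : TwistedL1 α) (g : G) :
    Summable fun k => a k * α k (b (k⁻¹ * g)) := (summable_norm_term a b g).of_norm

theorem norm_tsum_term_le (a b : TwistedL1 α) (g : G) :
    ‖∑' k, a k * α k (b (k⁻¹ * g))‖ ≤ ∑' k, ‖a k‖ * ‖b (k⁻¹ * g)‖ :=
  (norm_tsum_le_tsum_norm (summable_norm_term a b g)).trans
    ((summable_norm_term a b g).tsum_le_tsum (norm_term_le a b g)
      ((summable_conv a b).prod_factor g))

theorem summable_norm_conv (a b : TwistedL1 α) :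
    Summable fun g => ‖∑' k, a k * α k (b (k⁻¹ * g))‖ :=
  Summable.of_nonneg_of_le (fun _ => norm_nonneg _) (norm_tsum_term_le a b)
    (summable_conv a b).prod

/-- The twisted convolution product. -/
instance : Mul (TwistedL1 α) :=
  ⟨fun a b => ofSummable α (fun g => ∑' k, a k * α k (b (k⁻¹ * g))) (summable_norm_conv a b)⟩

theorem mul_apply (a b : TwistedL1 α) (g : G) :
    (a * b) g = ∑' k, a k * α k (b (k⁻¹ * g)) := rfl

theorem norm_mul_le' (a b : TwistedL1 α) : ‖a * b‖ ≤ ‖a‖ * ‖b‖ := by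
  rw [norm_eq_tsum (a * b), ← tsum_conv, (summable_conv a b).tsum_prod]
  exact (summable_norm_conv a b).tsum_le_tsum (norm_tsum_term_le a b) (summable_conv a b).prod

theorem norm_apply_le (a : TwistedL1 α) (g : G) : ‖a g‖ ≤ ‖a‖ :=
  lp.norm_apply_le_norm (p := 1) (by simp) (show lp (fun _ : G => A) 1 from a) g

theorem summable_triple (a b c : TwistedL1 α) (g : G) : Summable fun p : G × G =>
    a p.2 * α p.2 (b (p.2⁻¹ * p.1)) * α p.1 (c (p.1⁻¹ * g)) := by
  refine Summable.of_norm_bounded ((summable_conv a b).mul_right ‖c‖) fun p => ?_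
  refine (norm_mul_le _ _).trans ?_
  rw [norm_aut]
  exact mul_le_mul (norm_term_le a b p.1 p.2) (norm_apply_le c _) (norm_nonneg _) (by positivity)

theorem mul_mul_apply (a b c : TwistedL1 α) (g : G) : (a * b * c) g =
    ∑' k, ∑' j, a j * α j (b (j⁻¹ * k)) * α k (c (k⁻¹ * g)) := by
  rw [mul_apply]
  refine tsum_congr fun k => ?_
  rw [mul_apply, (summable_term a b k).tsum_mul_right]

theorem term_mul (a b c : TwistedL1 α) (g j : G) : a j * α j ((b * c) (j⁻¹ * g)) =
    ∑' k, a j * α j (b (j⁻¹ * k)) * α k (c (k⁻¹ * g)) := by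
  have h : Summable fun l => α j (b l * α l (c (l⁻¹ * (j⁻¹ * g)))) :=
    (summable_term b c (j⁻¹ * g)).map (α j) (StarAlgEquiv.isometry (α j)).continuous
  rw [mul_apply, aut_tsum _ (summable_term b c _), ← h.tsum_mul_left,
    ← (Equiv.mulLeft j).tsum_eq (fun k => a j * α j (b (j⁻¹ * k)) * α k (c (k⁻¹ * g)))]
  refine tsum_congr fun l => ?_
  rw [Equiv.coe_mulLeft, inv_mul_cancel_left, aut_mul, map_mul, mul_inv_rev, mul_assoc, mul_assoc]

theorem mul_assoc' (a b c : TwistedL1 α) : a * b * c = a * (b * c) := by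
  refine ext fun g => ?_
  rw [mul_mul_apply, mul_apply a (b * c), tsum_congr (term_mul a b c g)]
  exact (Summable.tsum_comm
    (f := fun k j => a j * α j (b (j⁻¹ * k)) * α k (c (k⁻¹ * g))) (summable_triple a b c g)).symm

/-- `ℓ¹(G, A; α)` is a (generally non-unital) normed ring. -/
instance : NonUnitalNormedRing (TwistedL1 α) where
  __ := (inferInstance : NormedAddCommGroup (TwistedL1 α))
  __ := (inferInstance : Mul (TwistedL1 α))
  left_distrib a b c := ext fun g => by
    simp only [mul_apply, add_apply, map_add, mul_add]
    exact (summable_term a b g).tsum_add (summable_term a c g)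
  right_distrib a b c := ext fun g => by
    simp only [mul_apply, add_apply, add_mul]
    exact (summable_term a c g).tsum_add (summable_term b c g)
  zero_mul a := ext fun g => by simp [mul_apply, zero_apply]
  mul_zero a := ext fun g => by simp [mul_apply, zero_apply]
  mul_assoc := mul_assoc'
  norm_mul_le := norm_mul_le'

instance : IsScalarTower ℂ (TwistedL1 α) (TwistedL1 α) :=
  ⟨fun c a b => ext fun g => by
    simp only [smul_eq_mul, mul_apply, smul_apply, smul_mul_assoc]
    exact (summable_term a b g).tsum_const_smul c⟩

instance : SMulCommClass ℂ (TwistedL1 α) (TwistedL1 α) :=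
  ⟨fun c a b => ext fun g => by
    simp only [smul_eq_mul, mul_apply, smul_apply, map_smul, mul_smul_comm]
    exact ((summable_term a b g).tsum_const_smul c).symm⟩

end TwistedL1

end TwistedL1

end

/-! Johnson's criterion: a Banach algebra is amenable once it carries a virtual diagonal, formally M
= Σ aᵢ ⊗ bᵢ with c·M = M·c and (Σ aᵢbᵢ)c = c. Only M as a functional on bounded bilinear forms is
needed, so no projective tensor product is built.

If M is a virtual diagonal of A and m a left invariant mean, then averaging δ_g M δ_{g⁻¹} over g
with m gives a virtual diagonal of ℓ¹(G, A; α) (`isVirtualDiagonal_mean`). M need not be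
α-invariant: a coefficient a₀ is transported into A by a power of the action depending on g and
absorbed by M for each g separately, while left invariance of m absorbs the shift by g₀.

It remains to find M. In finite dimension it is the Casimir element of the trace form of the regular
representation, which is nondegenerate because A is a C⋆-algebra. In the commutative case a weak-*
limit of e ⊗ e along an approximate unit gives the unit law, and averaging it over u ⊗ u* for the
commuting unitaries u of the unitization (Markov–Kakutani) gives the commutation law, as unitaries
span. -/

set_option maxSynthPendingDepth 3

noncomputable section

/-! ### Virtual diagonals and Johnson's criterion -/

section VirtualDiagonal

open ContinuousLinearMap

variable {B : Type*} [NonUnitalNormedRing B] [NormedSpace ℂ B]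
  [IsScalarTower ℂ B B] [SMulCommClass ℂ B B]

/-- A virtual diagonal of `B`: a bounded functional on the bounded bilinear forms on `B`, to be
thought of as an element of the bidual of the projective tensor square of `B`. -/
structure IsVirtualDiagonal (M : (B →L[ℂ] B →L[ℂ] ℂ) →L[ℂ] ℂ) : Prop where
  comm : ∀ (c : B) (φ χ ψ : B →L[ℂ] B →L[ℂ] ℂ), (∀ x y, χ x y = φ (c * x) y) →
    (∀ x y, ψ x y = φ x (y * c)) → M χ = M ψ
  unit : ∀ (c : B) (f : B →L[ℂ] ℂ) (φ : B →L[ℂ] B →L[ℂ] ℂ),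
    (∀ x y, φ x y = f (x * y * c)) → M φ = f c

variable (B) in
/-- The bounded bilinear form `(x, y) ↦ f (x * y)`, as a function of `f`. -/
def dualMul : (B →L[ℂ] ℂ) →L[ℂ] (B →L[ℂ] B →L[ℂ] ℂ) :=
  ((compL ℂ B (B →L[ℂ] B) (B →L[ℂ] ℂ)).flip (mul ℂ B)).comp (compL ℂ B B ℂ)

@[simp] theorem dualMul_apply (f : B →L[ℂ] ℂ) (x y : B) : dualMul B f x y = f (x * y) := rfl

namespace IsVirtualDiagonal

variable {M : (B →L[ℂ] B →L[ℂ] ℂ) →L[ℂ] ℂ}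

theorem apply_dualMul_right (hM : IsVirtualDiagonal M) (c : B) (f g : B →L[ℂ] ℂ)
    (h : ∀ b, g b = f (b * c)) : M (dualMul B g) = f c :=
  hM.unit c f _ fun x y => by rw [dualMul_apply, h]

/-- The commutation law moves c across, M(f(cxy)) = M(f(xyc)), so the right unit law also gives the
left one. -/
theorem apply_dualMul_left (hM : IsVirtualDiagonal M) (c : B) (f g : B →L[ℂ] ℂ)
    (h : ∀ b, g b = f (c * b)) : M (dualMul B g) = f c := by
  rw [← hM.apply_dualMul_right c f (f.comp ((mul ℂ B).flip c)) fun b => rfl]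
  refine hM.comm c (dualMul B f) _ _ (fun x y => ?_) fun x y => ?_
  · rw [dualMul_apply, dualMul_apply, h, mul_assoc]
  · simp [mul_assoc]

/-- A Banach algebra with a virtual diagonal is amenable. -/
theorem isAmenable [CompleteSpace B] (hM : IsVirtualDiagonal M) :
    IsAmenableBanachAlgebra.{_, w} B := by
  intro E _ _ _ N D hD
  have hD' (a b : B) (x : E) : D (a * b) x = D b (N.ract a x) + D a (N.lact b x) := by
    rw [hD a b]; rfl
  -- Formally, with e = Σ aᵢbᵢ: ξ = Σ aᵢ·D(bᵢ), ψ = D(e), ζ = e·ψ. The classical candidate ξ only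
  -- gives c·ξ − ξ·c = e·D(c), and e need not act as the identity on E*. The defect D(c) − e·D(c) is
  -- ψ·c; since c·ζ = c·ψ and ζ·c = 0, adding ζ − ψ repairs it.
  let ξ : StrongDual ℂ E := M.comp ((compL ℂ B E (B →L[ℂ] ℂ) D.flip).comp N.ract.flip)
  let ψ : StrongDual ℂ E := (M.comp (dualMul B)).comp D.flip
  let ζ : StrongDual ℂ E := (M.comp (dualMul B)).comp ((compL ℂ B E ℂ ψ).comp N.ract.flip)
  have hψ (c : B) (x : E) : ψ (N.lact c x) =
      D c x - M (dualMul B ((D c).comp (N.ract.flip x))) := by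
    have h1 : M (dualMul B (D.flip (N.lact c x) + (D c).comp (N.ract.flip x))) = D c x :=
      hM.apply_dualMul_right c (D.flip x) _ fun b => by simp [hD', add_comm]
    rw [← h1, map_add, map_add, add_sub_cancel_right]
    rfl
  have hξ (c : B) (x : E) : ξ (N.ract c x) - ξ (N.lact c x) =
      M (dualMul B ((D c).comp (N.ract.flip x))) := by
    have h1 : M (D.flip.comp (N.ract.flip (N.ract c x))) =
        M (D.flip.comp (N.ract.flip (N.lact c x)) +
          dualMul B ((D c).comp (N.ract.flip x))) := by
      refine hM.comm c (D.flip.comp (N.ract.flip x)) _ _ (fun a b => ?_) fun a b => ?_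
      · simp [N.ract_mul]
      · simp [hD', N.ract_mul, N.lact_ract, add_comm]
    rw [map_add] at h1
    exact sub_eq_of_eq_add' h1
  have hζr (c : B) (x : E) : ζ (N.ract c x) = ψ (N.ract c x) :=
    hM.apply_dualMul_left c (ψ.comp (N.ract.flip x)) _ fun b => by simp [N.ract_mul]
  have hζl (c : B) (x : E) : ζ (N.lact c x) = 0 := by
    have h0 : (compL ℂ B E ℂ ψ).comp N.ract.flip (N.lact c x) = 0 := by
      ext b
      have h1 := hψ c (N.ract b x)
      have h2 : M (dualMul B ((D c).comp (N.ract.flip (N.ract b x)))) = D c (N.ract b x) :=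
        hM.apply_dualMul_left b ((D c).comp (N.ract.flip x)) _ fun a => by simp [N.ract_mul]
      rw [h2, sub_self] at h1
      simpa [N.lact_ract] using h1
    change M (dualMul B ((compL ℂ B E ℂ ψ).comp N.ract.flip (N.lact c x))) = 0
    rw [h0, map_zero, map_zero]
  refine ⟨ξ + ζ - ψ, fun c => ?_⟩
  ext x
  change D c x = (ξ (N.ract c x) + ζ (N.ract c x) - ψ (N.ract c x)) -
    (ξ (N.lact c x) + ζ (N.lact c x) - ψ (N.lact c x))
  rw [hζl, hζr, hψ]
  linear_combination -hξ c x

end IsVirtualDiagonal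

end VirtualDiagonal

/-! ### Bounded families of functionals and pullbacks of forms -/

section BoundedFamilies

open ContinuousLinearMap

variable {V W F : Type*} [NormedAddCommGroup V] [NormedSpace ℂ V] [NormedAddCommGroup W]
  [NormedSpace ℂ W] [NormedAddCommGroup F] [NormedSpace ℂ F]

theorem norm_comp_le_of_norm_le_one (S : W →L[ℂ] F) {T : V →L[ℂ] W} (hT : ‖T‖ ≤ 1) :
    ‖S.comp T‖ ≤ ‖S‖ :=
  (opNorm_comp_le S T).trans (mul_le_of_le_one_right (norm_nonneg S) hT)

/-- A uniformly bounded family of functionals, as a map into `ℓ^∞`. -/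
def lpInftyOfBounded {ι : Type*} (Φ : ι → V →L[ℂ] ℂ) {C : ℝ} (hC : ∀ i, ‖Φ i‖ ≤ C) :
    V →L[ℂ] lp (fun _ : ι => ℂ) ∞ :=
  -- If ι is empty, C may be negative; hence `max C 0`.
  have bound (v : V) (i : ι) : ‖Φ i v‖ ≤ max C 0 * ‖v‖ :=
    (Φ i).le_of_opNorm_le ((hC i).trans (le_max_left C 0)) v
  LinearMap.mkContinuous
    { toFun := fun v => ⟨fun i => Φ i v,
        memℓp_infty ⟨max C 0 * ‖v‖, by rintro _ ⟨i, rfl⟩; exact bound v i⟩⟩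
      map_add' := fun v w => by ext i; exact map_add (Φ i) v w
      map_smul' := fun c v => by ext i; exact map_smul (Φ i) c v }
    (max C 0) fun v => lp.norm_le_of_forall_le (by positivity) (bound v)

/-- Pulling back bounded bilinear forms along a pair of bounded linear maps. -/
def bilinearPullback (S T : V →L[ℂ] W) :
    (W →L[ℂ] W →L[ℂ] ℂ) →L[ℂ] (V →L[ℂ] V →L[ℂ] ℂ) :=
  LinearMap.mkContinuous
    { toFun := fun φ => φ.bilinearComp S T
      map_add' := fun _ _ => rfl
      map_smul' := fun _ _ => rfl }
    (‖S‖ * ‖T‖) fun φ => opNorm_le_bound₂ _ (by positivity) fun x y => by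
      calc ‖φ (S x) (T y)‖ ≤ ‖φ‖ * ‖S x‖ * ‖T y‖ := φ.le_opNorm₂ _ _
        _ ≤ ‖φ‖ * (‖S‖ * ‖x‖) * (‖T‖ * ‖y‖) := by gcongr <;> exact le_opNorm _ _
        _ = ‖S‖ * ‖T‖ * ‖φ‖ * ‖x‖ * ‖y‖ := by ring

@[simp] theorem bilinearPullback_apply (S T : V →L[ℂ] W) (φ : W →L[ℂ] W →L[ℂ] ℂ) (x y : V) :
    bilinearPullback S T φ x y = φ (S x) (T y) := rfl

theorem norm_bilinearPullback_le (S T : V →L[ℂ] W) : ‖bilinearPullback S T‖ ≤ ‖S‖ * ‖T‖ :=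
  LinearMap.mkContinuous_norm_le _ (by positivity) _

end BoundedFamilies

/-! ### Averaging a virtual diagonal over the group -/

namespace TwistedL1

open ContinuousLinearMap

variable {G : Type*} [Group G] {A : Type*} [NonUnitalCStarAlgebra A]
  (α : G →* (A ≃⋆ₐ[ℂ] A))

open scoped Classical in
/-- The element of `ℓ¹(G, A; α)` with value `a` at `g` and zero elsewhere. -/
def single (g : G) : A →L[ℂ] TwistedL1 α :=
  lp.singleContinuousLinearMap ℂ (fun _ : G => A) 1 g

open scoped Classical in
theorem single_apply (g h : G) (a : A) : single α g a h = if h = g then a else 0 := by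
  change (lp.single 1 g a : lp (fun _ : G => A) 1) h = _
  rw [lp.coeFn_single, Pi.single_apply]

theorem norm_single_apply (g : G) (a : A) : ‖single α g a‖ = ‖a‖ := by
  classical
  exact lp.norm_single (E := fun _ : G => A) (p := 1) (by simp) g a

theorem norm_single_le (g : G) : ‖single α g‖ ≤ 1 :=
  opNorm_le_bound _ zero_le_one fun a => by rw [norm_single_apply, one_mul]

theorem single_mul_single (g h : G) (a b : A) :
    single α g a * single α h b = single α (g * h) (a * α g b) := by
  classical
  refine ext fun k => ?_
  rw [mul_apply, tsum_eq_single g fun l hl => by rw [single_apply, if_neg hl, zero_mul],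
    single_apply, single_apply, single_apply, if_pos rfl, inv_mul_eq_iff_eq_mul]
  split_ifs <;> simp

variable {α}

theorem clm_ext {F : Type*} [NormedAddCommGroup F] [NormedSpace ℂ F]
    {S T : TwistedL1 α →L[ℂ] F} (h : ∀ g a, S (single α g a) = T (single α g a)) : S = T := by
  classical
  exact lp.ext_continuousLinearMap (p := 1) (E := fun _ : G => A) (by simp)
    fun g => ContinuousLinearMap.ext fun a => h g a

variable (α)

theorem aut_aut_inv (g : G) (a : A) : α g (α g⁻¹ a) = a := by
  rw [← aut_mul, mul_inv_cancel, map_one]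
  rfl

/-- The action of `g` on `A` as a bounded linear map. -/
def autL (g : G) : A →L[ℂ] A :=
  LinearMap.mkContinuous ((α g : A ≃⋆ₐ[ℂ] A) : A →ₗ[ℂ] A) 1 fun a => by
    rw [one_mul]; exact (norm_aut g a).le

theorem norm_autL_le (g : G) : ‖autL α g‖ ≤ 1 :=
  LinearMap.mkContinuous_norm_le _ zero_le_one _

/-- The map sending `φ` to the bilinear form `(x, y) ↦ φ (δ_g x, y δ_{g⁻¹})` on `A`. -/
def coeffForm (g : G) :
    (TwistedL1 α →L[ℂ] TwistedL1 α →L[ℂ] ℂ) →L[ℂ] (A →L[ℂ] A →L[ℂ] ℂ) :=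
  -- The twist enters because δ_g x = α_g(x) δ_g.
  bilinearPullback ((single α g).comp (autL α g)) (single α g⁻¹)

theorem norm_coeffForm_le (g : G) : ‖coeffForm α g‖ ≤ 1 := by
  refine (norm_bilinearPullback_le _ _).trans ?_
  refine mul_le_one₀ ((opNorm_comp_le _ _).trans ?_) (norm_nonneg _) (norm_single_le α _)
  exact mul_le_one₀ (norm_single_le α g) (norm_nonneg _) (norm_autL_le α g)

/-- The bounded function `g ↦ M (φ (δ_g ·, · δ_{g⁻¹}))` on `G`, as a function of `φ`. -/
def coeffFun (M : (A →L[ℂ] A →L[ℂ] ℂ) →L[ℂ] ℂ) :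
    (TwistedL1 α →L[ℂ] TwistedL1 α →L[ℂ] ℂ) →L[ℂ] lp (fun _ : G => ℂ) ∞ :=
  lpInftyOfBounded (fun g => M.comp (coeffForm α g)) fun g =>
    norm_comp_le_of_norm_le_one M (norm_coeffForm_le α g)

variable {α}

theorem isVirtualDiagonal_mean {m : lp (fun _ : G => ℂ) ∞ →L[ℂ] ℂ} (hm : IsLeftInvariantMean m)
    {M : (A →L[ℂ] A →L[ℂ] ℂ) →L[ℂ] ℂ} (hM : IsVirtualDiagonal M) :
    IsVirtualDiagonal (m.comp (coeffFun α M)) where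
  comm := by
    intro c φ χ ψ hχ hψ
    let B := TwistedL1 α
    let P : B →L[ℂ] ℂ := (m.comp (coeffFun α M)).comp
      ((compL ℂ B B (B →L[ℂ] ℂ) φ).comp (mul ℂ B))
    let Q : B →L[ℂ] ℂ := (m.comp (coeffFun α M)).comp
      (((compL ℂ B (B →L[ℂ] ℂ) (B →L[ℂ] ℂ)).flip φ).comp
        ((compL ℂ B B ℂ).flip.comp (mul ℂ B).flip))
    have hχP : m (coeffFun α M χ) = P c := by
      have : χ = (compL ℂ B B (B →L[ℂ] ℂ) φ).comp (mul ℂ B) c := by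
        ext x y; exact hχ x y
      rw [this]; rfl
    have hψQ : m (coeffFun α M ψ) = Q c := by
      have : ψ = ((compL ℂ B (B →L[ℂ] ℂ) (B →L[ℂ] ℂ)).flip φ).comp
        ((compL ℂ B B ℂ).flip.comp (mul ℂ B).flip) c := by
        ext x y; exact hψ x y
      rw [this]; rfl
    have hPQ : P = Q := by
      refine clm_ext fun g₀ a₀ => ?_
      -- Invariance lets the right side be read at g₀g. With c = α_{(g₀g)⁻¹}(a₀), one has
      -- a₀δ_{g₀}·δ_g x = δ_{g₀g} cx and yδ_{(g₀g)⁻¹}·a₀δ_{g₀} = ycδ_{g⁻¹}, so the commutation law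
      -- of M for c applies at each g.
      refine Eq.trans ?_ (hm.2.2 g₀ (coeffFun α M _))
      refine congrArg m ?_
      ext g
      change M _ = M _
      refine hM.comm (α (g₀ * g)⁻¹ a₀) (φ.bilinearComp ((single α (g₀ * g)).comp
        (autL α (g₀ * g))) (single α g⁻¹)) _ _ (fun x y => ?_) fun x y => ?_
      · change φ (single α g₀ a₀ * single α g (α g x)) (single α g⁻¹ y) =
          φ (single α (g₀ * g) (α (g₀ * g) (α (g₀ * g)⁻¹ a₀ * x))) (single α g⁻¹ y)
        rw [single_mul_single, map_mul (α (g₀ * g)), aut_aut_inv, aut_mul]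
      · change φ (single α (g₀ * g) (α (g₀ * g) x))
            (single α (g₀ * g)⁻¹ y * single α g₀ a₀) =
          φ (single α (g₀ * g) (α (g₀ * g) x)) (single α g⁻¹ (y * α (g₀ * g)⁻¹ a₀))
        rw [single_mul_single]
        simp
    rw [comp_apply, comp_apply, hχP, hψQ, hPQ]
  unit := by
    intro c f φ hφ
    let B := TwistedL1 α
    let P : B →L[ℂ] ℂ := (m.comp (coeffFun α M)).comp
      ((dualMul B).comp ((compL ℂ B B ℂ f).comp (mul ℂ B).flip))
    have hφP : m (coeffFun α M φ) = P c := by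
      have : φ = (dualMul B).comp ((compL ℂ B B ℂ f).comp (mul ℂ B).flip) c := by
        ext x y; exact hφ x y
      rw [this]; rfl
    have hP : P = f := by
      refine clm_ext fun g₀ a₀ => ?_
      change m (coeffFun α M _) = _
      -- The averaged function is constant in g, since δ_g xy δ_{g⁻¹} a₀ = α_g(xy α_{g⁻¹}(a₀)) and M
      -- has the unit law; then m(1) = 1 finishes.
      suffices h : coeffFun α M _ = f (single α g₀ a₀) • 1 by
        refine (congrArg m h).trans ?_
        rw [map_smul, hm.2.1, smul_eq_mul, mul_one]
      · ext g
        change M _ = f (single α g₀ a₀) * 1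
        rw [mul_one, hM.unit (α g⁻¹ a₀) (f.comp ((single α g₀).comp (autL α g)))]
        · change f (single α g₀ (α g (α g⁻¹ a₀))) = _
          rw [aut_aut_inv]
        · intro x y
          change f (single α g (α g x) * single α g⁻¹ y * single α g₀ a₀) =
            f (single α g₀ (α g (x * y * α g⁻¹ a₀)))
          rw [single_mul_single, single_mul_single, map_mul (α g) (x * y), map_mul (α g),
            aut_aut_inv]
          simp
    rw [comp_apply, hφP, hP]

/-- If `G` is amenable and `A` has a virtual diagonal, then `ℓ¹(G, A; α)` is amenable. -/
theorem isAmenable (hG : IsAmenableGroup G) (α : G →* (A ≃⋆ₐ[ℂ] A))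
    (hA : ∃ M : (A →L[ℂ] A →L[ℂ] ℂ) →L[ℂ] ℂ, IsVirtualDiagonal M) :
    IsAmenableBanachAlgebra.{_, w} (TwistedL1 α) := by
  obtain ⟨m, hm⟩ := hG
  obtain ⟨M, hM⟩ := hA
  exact (isVirtualDiagonal_mean hm hM).isAmenable

end TwistedL1

/-! ### Finite-dimensional algebras: the trace form and its Casimir element -/

section FiniteDimensional

open Polynomial in
/-- In characteristic zero, an endomorphism all of whose powers are traceless is nilpotent. -/
theorem isNilpotent_of_trace_pow_eq_zero {K V : Type*} [Field K] [CharZero K] [AddCommGroup V]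
    [Module K V] [FiniteDimensional K V] (f : Module.End K V)
    (h : ∀ n : ℕ, LinearMap.trace K V (f ^ (n + 1)) = 0) : IsNilpotent f := by
  have hint : IsIntegral K f := Algebra.IsIntegral.isIntegral f
  obtain ⟨q, hq, hX⟩ := exists_eq_pow_rootMultiplicity_mul_and_not_dvd (minpoly K f)
    (minpoly.ne_zero hint) 0
  set k := rootMultiplicity 0 (minpoly K f)
  rw [map_zero, sub_zero] at hq hX
  -- The minimal polynomial is X^k q with q prime to X. The Bézout term e = r(f) f^(k+1) is the
  -- projection off the generalized kernel. The exponent k + 1 instead of k leaves no constant term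
  -- even for k = 0, so e is traceless, hence 0.
  obtain ⟨r, s, hrs⟩ : IsCoprime (X ^ (k + 1)) q :=
    ((irreducible_X.coprime_iff_not_dvd).mpr hX).pow_left
  have hfq : f ^ k * aeval f q = 0 := by
    have := minpoly.aeval K f
    rwa [hq, map_mul, map_pow, aeval_X] at this
  have hone : aeval f (r * X ^ (k + 1)) + aeval f s * aeval f q = 1 := by
    rw [← map_mul, ← map_add, hrs, map_one]
  set e := aeval f (r * X ^ (k + 1)) with he
  have hfqe : e * (aeval f s * aeval f q) = 0 := by
    have h1 : e = aeval f (r * X) * f ^ k := by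
      rw [he, pow_succ', ← mul_assoc, map_mul _ (r * X), map_pow, aeval_X]
    have h2 : aeval f s * aeval f q = aeval f q * aeval f s := by
      rw [← map_mul, mul_comm, map_mul]
    rw [h1, h2, mul_assoc, ← mul_assoc (f ^ k), hfq, zero_mul, mul_zero]
  have hidem : IsIdempotentElem e := by
    have := congrArg (e * ·) hone
    simp only [mul_add, hfqe, add_zero, mul_one] at this
    exact this
  have htr : LinearMap.trace K V e = 0 := by
    rw [he, map_mul, aeval_eq_sum_range, Finset.sum_mul, map_sum]
    refine Finset.sum_eq_zero fun i _ => ?_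
    rw [map_pow, aeval_X, smul_mul_assoc, ← pow_add, map_smul, ← add_assoc, h, smul_zero]
  have he0 : e = 0 := LinearMap.IsIdempotentElem.eq_zero_of_trace_eq_zero hidem htr
  refine ⟨k, ?_⟩
  rw [he0, zero_add] at hone
  have h2 : aeval f s * aeval f q = aeval f q * aeval f s := by
    rw [← map_mul, mul_comm, map_mul]
  rw [← mul_one (f ^ k), ← hone, h2, ← mul_assoc, hfq, zero_mul]

variable {A : Type*} [NonUnitalCStarAlgebra A]

/-- With no unit assumed, `(LinearMap.mulLeft ℂ h ^ n) h` plays the role of h^(n+1). -/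
theorem mulLeft_pow_succ (h : A) (n : ℕ) : LinearMap.mulLeft ℂ h ^ (n + 1) =
    LinearMap.mulLeft ℂ ((LinearMap.mulLeft ℂ h ^ n) h) := by
  induction n with
  | zero => simp
  | succ n ih =>
    conv_lhs => rw [pow_succ', ih]
    rw [pow_succ', Module.End.mul_apply]
    ext x
    simp

/-- A self-adjoint element whose left multiplication is nilpotent vanishes. -/
theorem IsSelfAdjoint.eq_zero_of_isNilpotent_mulLeft {h : A} (hh : IsSelfAdjoint h)
    (hn : IsNilpotent (LinearMap.mulLeft ℂ h)) : h = 0 := by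
  set L := LinearMap.mulLeft ℂ h
  have descend (n : ℕ) (h0 : L ^ (n + 2) = 0) : L ^ (n + 1) = 0 := by
    ext v
    have h1 : (L ^ (n + 1)) v = h * (L ^ n) v := by rw [pow_succ']; rfl
    have h2 : h * (h * (L ^ n) v) = 0 := by
      have := LinearMap.congr_fun h0 v
      rwa [pow_succ', pow_succ'] at this
    -- C⋆-identity: for w = Lⁿv, (hw)*(hw) = w*(h(hw)) = 0.
    rw [h1, LinearMap.zero_apply, ← CStarRing.star_mul_self_eq_zero_iff, star_mul, hh.star_eq,
      mul_assoc, h2, mul_zero]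
  have h1 : L ^ 1 = 0 := by
    obtain ⟨n, hn⟩ := hn
    have h0 : L ^ (n + 1) = 0 := by rw [pow_succ, hn, zero_mul]
    clear hn
    induction n with
    | zero => exact h0
    | succ n ih => exact ih (descend n h0)
  rw [← CStarRing.star_mul_self_eq_zero_iff, hh.star_eq]
  rw [pow_one] at h1
  exact LinearMap.congr_fun h1 h

variable (A) in
/-- The trace form `(x, y) ↦ Tr (L_{x y})` of an algebra. -/
def regularTraceForm : LinearMap.BilinForm ℂ A :=
  (LinearMap.mul ℂ A).compr₂ (LinearMap.trace ℂ A ∘ₗ LinearMap.mul ℂ A)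

theorem regularTraceForm_apply (x y : A) : regularTraceForm A x y =
    LinearMap.trace ℂ A (LinearMap.mulLeft ℂ (x * y)) := rfl

theorem regularTraceForm_comm (x y : A) : regularTraceForm A x y = regularTraceForm A y x := by
  rw [regularTraceForm_apply, regularTraceForm_apply, LinearMap.mulLeft_mul, LinearMap.mulLeft_mul]
  exact LinearMap.trace_mul_comm ℂ _ _

theorem regularTraceForm_mul (x y z : A) :
    regularTraceForm A (x * y) z = regularTraceForm A x (y * z) := by
  rw [regularTraceForm_apply, regularTraceForm_apply, mul_assoc]

variable [FiniteDimensional ℂ A]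

/-- All powers of xx* lie in xA, so left multiplication by xx* has traceless powers and is
nilpotent; xx* is self-adjoint, hence 0. -/
theorem eq_zero_of_regularTraceForm_eq_zero {x : A} (hx : ∀ y, regularTraceForm A x y = 0) :
    x = 0 := by
  have hrange (n : ℕ) : ∃ y, (LinearMap.mulLeft ℂ (x * star x) ^ n) (x * star x) = x * y := by
    cases n with
    | zero => exact ⟨_, rfl⟩
    | succ n => exact ⟨_, by rw [pow_succ', Module.End.mul_apply, LinearMap.mulLeft_apply,
        mul_assoc]⟩
  have hnil : IsNilpotent (LinearMap.mulLeft ℂ (x * star x)) := by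
    refine isNilpotent_of_trace_pow_eq_zero _ fun n => ?_
    obtain ⟨y, hy⟩ := hrange n
    rw [mulLeft_pow_succ, hy]
    exact hx y
  exact (CStarRing.mul_star_self_eq_zero_iff x).mp
    ((IsSelfAdjoint.mul_star_self x).eq_zero_of_isNilpotent_mulLeft hnil)

variable (A) in
theorem regularTraceForm_nondegenerate : (regularTraceForm A).Nondegenerate :=
  ⟨fun _ hx => eq_zero_of_regularTraceForm_eq_zero hx, fun x hx =>
    eq_zero_of_regularTraceForm_eq_zero fun y => by rw [regularTraceForm_comm]; exact hx y⟩

/-- A finite-dimensional C⋆-algebra has a virtual diagonal: the Casimir element of the trace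
form. -/
theorem exists_isVirtualDiagonal_of_finiteDimensional :
    ∃ M : (A →L[ℂ] A →L[ℂ] ℂ) →L[ℂ] ℂ, IsVirtualDiagonal M := by
  classical
  let τ := regularTraceForm A
  have hτ : τ.Nondegenerate := regularTraceForm_nondegenerate A
  let b := Module.finBasis ℂ A
  let d := τ.dualBasis hτ b
  have hd (x : A) : ∑ i, τ x (b i) • d i = x := by
    conv_rhs => rw [← d.sum_repr x]
    exact Finset.sum_congr rfl fun i _ => by rw [LinearMap.BilinForm.dualBasis_repr_apply]
  have hbd (i j) : τ (d i) (b j) = if j = i then 1 else 0 :=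
    LinearMap.BilinForm.apply_dualBasis_left (hB := hτ) (b := b) i j
  have hb_repr (x : A) (i) : b.repr x i = τ (d i) x := by
    conv_rhs => rw [← b.sum_repr x]
    simp only [map_sum, map_smul, hbd, smul_eq_mul, mul_ite, mul_one, mul_zero,
      Finset.sum_ite_eq', Finset.mem_univ, if_true]
  have hb (x : A) : ∑ i, τ (d i) x • b i = x := by
    conv_rhs => rw [← b.sum_repr x]
    exact Finset.sum_congr rfl fun i _ => by rw [hb_repr]
  have htr (y : A) : LinearMap.trace ℂ A (LinearMap.mulLeft ℂ y) = τ (∑ i, b i * d i) y := by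
    rw [LinearMap.trace_eq_matrix_trace ℂ b, Matrix.trace, map_sum, LinearMap.sum_apply]
    refine Finset.sum_congr rfl fun i _ => ?_
    rw [Matrix.diag_apply, LinearMap.toMatrix_apply, hb_repr, LinearMap.mulLeft_apply]
    change regularTraceForm A _ _ = regularTraceForm A _ _
    rw [← regularTraceForm_mul, regularTraceForm_comm, ← regularTraceForm_mul]
  -- Both sides pair with y to Tr(L_{cy}), so nondegeneracy makes Σ bᵢdᵢ a left unit.
  have hone (c : A) : (∑ i, b i * d i) * c = c := by
    rw [← sub_eq_zero]
    refine eq_zero_of_regularTraceForm_eq_zero fun y => ?_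
    rw [map_sub, LinearMap.sub_apply, sub_eq_zero, regularTraceForm_mul]
    exact (htr (c * y)).symm
  refine ⟨∑ i, (ContinuousLinearMap.apply ℂ ℂ (d i)).comp
    (ContinuousLinearMap.apply ℂ (A →L[ℂ] ℂ) (b i)), ?_, ?_⟩
  · intro c φ χ ψ hχ hψ
    simp only [sum_apply, ContinuousLinearMap.comp_apply,
      ContinuousLinearMap.apply_apply, hχ, hψ]
    -- Expanded in b and d respectively, c bᵢ and dⱼ c have the same coefficients by associativity
    -- of τ.
    have h1 (i) : φ (c * b i) (d i) = ∑ j, τ (d j) (c * b i) * φ (b j) (d i) := by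
      conv_lhs => rw [← hb (c * b i)]
      simp
    have h2 (j) : φ (b j) (d j * c) = ∑ i, τ (d j * c) (b i) * φ (b j) (d i) := by
      conv_lhs => rw [← hd (d j * c)]
      simp
    simp_rw [h1, h2]
    rw [Finset.sum_comm]
    refine Finset.sum_congr rfl fun j _ => Finset.sum_congr rfl fun i _ => ?_
    rw [show τ (d j * c) (b i) = τ (d j) (c * b i) from regularTraceForm_mul _ _ _]
  · intro c f φ hφ
    simp only [sum_apply, ContinuousLinearMap.comp_apply,
      ContinuousLinearMap.apply_apply, hφ]
    rw [← map_sum, ← Finset.sum_mul, hone]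

end FiniteDimensional

/-! ### Averaging functionals over commuting contractions -/

section InvariantFunctional

open Filter Topology ContinuousLinearMap

variable {V : Type*} [NormedAddCommGroup V] [NormedSpace ℂ V]

/-- A bounded family of functionals has a weak-* cluster point, which computes all pointwise
limits that exist. -/
theorem exists_functional_eq_of_tendsto {ι : Type*} (l : Filter ι) [l.NeBot] (M : ι → V →L[ℂ] ℂ)
    {C : ℝ} (hM : ∀ᶠ i in l, ‖M i‖ ≤ C) :
    ∃ N : V →L[ℂ] ℂ, ∀ v z, Tendsto (fun i => M i v) l (𝓝 z) → N v = z := by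
  let 𝒰 := Ultrafilter.of l
  let M' : ι → WeakDual ℂ V := fun i => StrongDual.toWeakDual (M i)
  obtain ⟨N, -, hN⟩ := (WeakDual.isCompact_closedBall (0 : StrongDual ℂ V) C).ultrafilter_le_nhds'
    (𝒰.map M') (by
      rw [Ultrafilter.mem_map]
      refine Ultrafilter.of_le l ?_
      filter_upwards [hM] with i hi
      change M i ∈ Metric.closedBall (0 : StrongDual ℂ V) C
      rwa [mem_closedBall_zero_iff])
  refine ⟨WeakDual.toStrongDual N, fun v z hz => ?_⟩
  refine tendsto_nhds_unique (f := fun i => M i v) (l := (𝒰 : Filter ι)) ?_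
    (hz.mono_left (Ultrafilter.of_le l))
  have hN' : Tendsto M' 𝒰 (𝓝 N) := hN
  exact ((WeakDual.eval_continuous v).tendsto N).comp hN'

/-- The Cesàro mean of the powers of `T`. -/
def cesaroMean (T : V →L[ℂ] V) (n : ℕ) : V →L[ℂ] V :=
  ((n + 1 : ℕ) : ℂ)⁻¹ • ∑ j ∈ Finset.range (n + 1), T ^ j

theorem norm_pow_le_one_of_norm_le_one {T : V →L[ℂ] V} (hT : ‖T‖ ≤ 1) (n : ℕ) : ‖T ^ n‖ ≤ 1 := by
  induction n with
  | zero => exact norm_id_le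
  | succ n ih =>
    rw [pow_succ]
    exact (norm_mul_le _ _).trans (mul_le_one₀ ih (norm_nonneg _) hT)

theorem norm_cesaroMean_le {T : V →L[ℂ] V} (hT : ‖T‖ ≤ 1) (n : ℕ) : ‖cesaroMean T n‖ ≤ 1 := by
  rw [cesaroMean, norm_smul, norm_inv, Complex.norm_natCast]
  refine inv_mul_le_one_of_le₀ ?_ (by positivity)
  refine (norm_sum_le_of_le _ fun j _ => norm_pow_le_one_of_norm_le_one hT j).trans ?_
  simp

/-- The sum telescopes to (T^(n+1) − 1)/(n + 1). -/
theorem norm_cesaroMean_mul_le {T : V →L[ℂ] V} (hT : ‖T‖ ≤ 1) (n : ℕ) :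
    ‖cesaroMean T n * (T - 1)‖ ≤ 2 * (1 / ((n : ℝ) + 1)) := by
  rw [cesaroMean, smul_mul_assoc, geom_sum_mul, norm_smul, norm_inv, Complex.norm_natCast,
    Nat.cast_succ, mul_comm, one_div]
  gcongr
  refine (norm_sub_le _ _).trans ?_
  have h1 := norm_pow_le_one_of_norm_le_one hT (n + 1)
  have h2 : ‖(1 : V →L[ℂ] V)‖ ≤ 1 := norm_id_le
  linarith

theorem cesaroMean_apply_of_fixed {T : V →L[ℂ] V} {v : V} (hv : T v = v) (n : ℕ) :
    cesaroMean T n v = v := by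
  have h (j : ℕ) : (T ^ j) v = v := by
    induction j with
    | zero => rfl
    | succ j ih => rw [pow_succ, mul_apply_eq_comp, hv, ih]
  rw [cesaroMean, smul_apply, sum_apply, Finset.sum_congr rfl fun j _ => h j, Finset.sum_const,
    Finset.card_range, ← Nat.cast_smul_eq_nsmul ℂ, smul_smul, inv_mul_cancel₀ (Nat.cast_ne_zero.mpr n.succ_ne_zero),
    one_smul]

theorem Commute.cesaroMean {S T : V →L[ℂ] V} (h : Commute S T) (n : ℕ) :
    Commute (cesaroMean S n) (cesaroMean T n) :=
  ((Commute.sum_left _ _ _ fun _ _ => Commute.sum_right _ _ _ fun _ _ =>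
    h.pow_pow _ _).smul_left _).smul_right _

theorem Commute.bilinearPullback {S S' T T' : V →L[ℂ] V} (hS : Commute S S') (hT : Commute T T') :
    Commute (bilinearPullback S T) (bilinearPullback S' T') := by
  ext φ x y
  have h1 : S' (S x) = S (S' x) := congrArg (fun R : V →L[ℂ] V => R x) hS.symm.eq
  have h2 : T' (T y) = T (T' y) := congrArg (fun R : V →L[ℂ] V => R y) hT.symm.eq
  change φ (S' (S x)) (T' (T y)) = φ (S (S' x)) (T (T' y))
  rw [h1, h2]

/-- A form of the Markov–Kakutani theorem: a functional can be averaged over a commuting family of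
contractions without changing its values on the vectors fixed by the family. -/
theorem exists_invariant_functional {ι : Type*} (T : ι → V →L[ℂ] V)
    (hcomm : ∀ i j, Commute (T i) (T j)) (hT : ∀ i, ‖T i‖ ≤ 1) (M₀ : V →L[ℂ] ℂ) :
    ∃ M : V →L[ℂ] ℂ, (∀ i v, M (T i v) = M v) ∧ ∀ v, (∀ i, T i v = v) → M v = M₀ v := by
  classical
  have hc (n : ℕ) (s : Set ι) : s.Pairwise (Function.onFun Commute fun i => cesaroMean (T i) n) :=
    fun i _ j _ _ => (hcomm i j).cesaroMean n
  -- Products of Cesàro means over finite sets of indices. By commutativity any factor i can be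
  -- moved next to Tᵢ − 1, so S kills Tᵢv − v in the limit.
  let S : Finset ι × ℕ → V →L[ℂ] V := fun p =>
    p.1.noncommProd (fun i => cesaroMean (T i) p.2) (hc p.2 _)
  have hprod (n : ℕ) (s : Finset ι) :
      ‖s.noncommProd (fun i => cesaroMean (T i) n) (hc n _)‖ ≤ 1 :=
    Finset.noncommProd_induction s _ _ (fun R => ‖R‖ ≤ 1)
      (fun _ _ ha hb => (norm_mul_le _ _).trans (mul_le_one₀ ha (norm_nonneg _) hb))
      norm_id_le fun i _ => norm_cesaroMean_le (hT i) n
  obtain ⟨M, hM⟩ := exists_functional_eq_of_tendsto (atTop : Filter (Finset ι × ℕ))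
    (fun p => M₀.comp (S p)) (C := ‖M₀‖)
    (Eventually.of_forall fun p => norm_comp_le_of_norm_le_one M₀ (hprod p.2 p.1))
  refine ⟨M, fun i v => ?_, fun v hv => hM v _ ?_⟩
  · rw [← sub_eq_zero, ← map_sub]
    refine hM _ 0 ?_
    have hlim : Tendsto (fun p : Finset ι × ℕ => ‖M₀‖ * (2 * (1 / ((p.2 : ℝ) + 1)) * ‖v‖))
        atTop (𝓝 0) := by
      have h1 : Tendsto (fun p : Finset ι × ℕ => p.2) atTop atTop := by
        rw [← prod_atTop_atTop_eq]; exact tendsto_snd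
      simpa using (((tendsto_one_div_add_atTop_nhds_zero_nat (𝕜 := ℝ)).comp h1).const_mul
        2).mul_const ‖v‖ |>.const_mul ‖M₀‖
    refine squeeze_zero_norm' ?_ hlim
    filter_upwards [eventually_ge_atTop (({i} : Finset ι), 0)] with p hp
    have hi : i ∈ p.1 := hp.1 (Finset.mem_singleton_self i)
    rw [comp_apply]
    refine (M₀.le_opNorm _).trans ?_
    gcongr
    have h1 : S p (T i v - v) = ((p.1.erase i).noncommProd (fun i => cesaroMean (T i) p.2)
        (hc p.2 _)) ((cesaroMean (T i) p.2 * (T i - 1)) v) := by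
      have h2 : S p = (p.1.erase i).noncommProd (fun i => cesaroMean (T i) p.2) (hc p.2 _) *
          cesaroMean (T i) p.2 := (Finset.noncommProd_erase_mul p.1 hi _ _).symm
      rw [h2]
      rfl
    rw [h1]
    refine (le_of_opNorm_le _ (hprod p.2 _) _).trans ?_
    rw [one_mul]
    exact le_of_opNorm_le _ (norm_cesaroMean_mul_le (hT i) p.2) v
  · have hS (p : Finset ι × ℕ) : S p v = v :=
      Finset.noncommProd_induction p.1 _ _ (fun R : V →L[ℂ] V => R v = v)
        (fun a b ha hb => by rw [mul_apply_eq_comp, hb, ha]) rfl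
        fun i _ => cesaroMean_apply_of_fixed (hv i) p.2
    simp only [comp_apply, hS]
    exact tendsto_const_nhds

end InvariantFunctional

/-! ### Commutative algebras: averaging over unitaries of the unitization -/

section Commutative

open Filter Topology ContinuousLinearMap

variable {A : Type*} [NonUnitalCStarAlgebra A]

/-- There is a bounded functional on bilinear forms which is the limit of the evaluations at
`(e, e)`, where `e` runs through an approximate unit. -/
theorem exists_functional_apply_mul : ∃ M : (A →L[ℂ] A →L[ℂ] ℂ) →L[ℂ] ℂ,
    ∀ (c : A) (f : A →L[ℂ] ℂ) (φ : A →L[ℂ] A →L[ℂ] ℂ),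
      (∀ x y, φ x y = f (x * y * c)) → M φ = f c := by
  let _ := CStarAlgebra.spectralOrder A
  have _ := CStarAlgebra.spectralOrderedRing A
  have hl := CStarAlgebra.increasingApproximateUnit A
  obtain ⟨M, hM⟩ := exists_functional_eq_of_tendsto (CStarAlgebra.approximateUnit A)
    (fun e : A => (apply ℂ ℂ e).comp (apply ℂ (A →L[ℂ] ℂ) e)) (C := 1) (by
      filter_upwards [hl.eventually_norm] with e he
      refine opNorm_le_bound _ zero_le_one fun φ => ?_
      calc ‖φ e e‖ ≤ ‖φ‖ * ‖e‖ * ‖e‖ := φ.le_opNorm₂ e e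
        _ ≤ ‖φ‖ * 1 * 1 := by gcongr
        _ = 1 * ‖φ‖ := by ring)
  refine ⟨M, fun c f φ hφ => hM φ _ ?_⟩
  simp only [comp_apply, apply_apply, hφ]
  refine (f.continuous.tendsto c).comp ?_
  have h1 : Tendsto (fun e : A => e * c) (CStarAlgebra.approximateUnit A) (𝓝 c) :=
    hl.tendsto_mul_right c
  have h2 : Tendsto (fun e : A => e * (e * c - c)) (CStarAlgebra.approximateUnit A) (𝓝 0) := by
    refine squeeze_zero_norm' (a := fun e : A => ‖e * c - c‖) ?_ ?_
    · filter_upwards [hl.eventually_norm] with e he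
      exact (norm_mul_le _ _).trans (mul_le_of_le_one_left (norm_nonneg _) he)
    · simpa using (h1.sub_const c).norm
  simpa [mul_sub, mul_assoc] using h2.add h1

/-- The action of the unitization of `A` on `A` by left multiplication. -/
def unitizationMul (w : Unitization ℂ A) : A →L[ℂ] A := (Unitization.splitMul ℂ A w).2

theorem unitizationMul_apply (w : Unitization ℂ A) (x : A) :
    unitizationMul w x = w.fst • x + w.snd * x := by
  simp [unitizationMul, Algebra.algebraMap_eq_smul_one]

theorem inr_unitizationMul (w : Unitization ℂ A) (x : A) :
    (unitizationMul w x : Unitization ℂ A) = w * x := by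
  rw [unitizationMul_apply]
  ext <;> simp

/-- The norm of the unitization is the maximum of the norms of the scalar part and of this
multiplication operator. -/
theorem norm_unitizationMul_le (w : Unitization ℂ A) : ‖unitizationMul w‖ ≤ ‖w‖ := by
  rw [Unitization.norm_def]
  exact norm_snd_le _

theorem unitizationMul_mul (w z : Unitization ℂ A) (x : A) :
    unitizationMul w (unitizationMul z x) = unitizationMul (w * z) x := by
  refine Unitization.inr_injective (R := ℂ) ?_
  simp only [inr_unitizationMul, mul_assoc]

theorem unitizationMul_one (x : A) : unitizationMul (1 : Unitization ℂ A) x = x := by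
  simp [unitizationMul_apply]

theorem commute_unitizationMul (h : ∀ w z : Unitization ℂ A, w * z = z * w)
    (w z : Unitization ℂ A) : Commute (unitizationMul w) (unitizationMul z) := by
  ext x
  rw [mul_apply_eq_comp, mul_apply_eq_comp, unitizationMul_mul, unitizationMul_mul, h]

/-- A commutative C⋆-algebra has a virtual diagonal. -/
theorem exists_isVirtualDiagonal_of_commutative (hA : ∀ a b : A, a * b = b * a) :
    ∃ M : (A →L[ℂ] A →L[ℂ] ℂ) →L[ℂ] ℂ, IsVirtualDiagonal M := by
  have hA' (w z : Unitization ℂ A) : w * z = z * w := by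
    ext
    · simp [mul_comm]
    · simp [hA w.snd z.snd, add_comm]
  obtain ⟨M₀, hM₀⟩ := exists_functional_apply_mul (A := A)
  let T : unitary (Unitization ℂ A) → (A →L[ℂ] A →L[ℂ] ℂ) →L[ℂ] (A →L[ℂ] A →L[ℂ] ℂ) := fun w =>
    bilinearPullback (unitizationMul (w : Unitization ℂ A))
      (unitizationMul (star (w : Unitization ℂ A)))
  have hnorm (w : unitary (Unitization ℂ A)) : ‖unitizationMul (w : Unitization ℂ A)‖ ≤ 1 :=
    (norm_unitizationMul_le _).trans (CStarRing.norm_coe_unitary w).le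
  have hT (w) : ‖T w‖ ≤ 1 :=
    (norm_bilinearPullback_le _ _).trans (mul_le_one₀ (hnorm w) (norm_nonneg _) (hnorm (star w)))
  have hcomm (w z) : Commute (T w) (T z) :=
    (commute_unitizationMul hA' _ _).bilinearPullback (commute_unitizationMul hA' _ _)
  obtain ⟨M, hMT, hM⟩ := exists_invariant_functional T hcomm hT M₀
  have key (φ : A →L[ℂ] A →L[ℂ] ℂ) (w : Unitization ℂ A) :
      M (bilinearPullback (unitizationMul w) (.id ℂ A) φ) =
        M (bilinearPullback (.id ℂ A) (unitizationMul w) φ) := by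
    have hw : w ∈ Submodule.span ℂ (unitary (Unitization ℂ A) : Set (Unitization ℂ A)) := by
      rw [CStarAlgebra.span_unitary]; trivial
    induction hw using Submodule.span_induction with
    | mem u hu =>
      -- Applying u ⊗ u* to the form φ(x, uy) gives φ(ux, uu*y) = φ(ux, y).
      rw [← hMT ⟨u, hu⟩ (bilinearPullback (.id ℂ A) (unitizationMul u) φ)]
      congr 1
      ext x y
      change φ (unitizationMul u x) y =
        φ (unitizationMul u x) (unitizationMul u (unitizationMul (star u) y))
      rw [unitizationMul_mul, Unitary.mul_star_self_of_mem hu, unitizationMul_one]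
    | zero =>
      congr 1
      ext x y
      simp [unitizationMul]
    | add w z _ _ hw hz =>
      have h1 : bilinearPullback (unitizationMul (w + z)) (.id ℂ A) φ =
          bilinearPullback (unitizationMul w) (.id ℂ A) φ +
            bilinearPullback (unitizationMul z) (.id ℂ A) φ := by
        ext x y; simp [unitizationMul]; ring
      have h2 : bilinearPullback (.id ℂ A) (unitizationMul (w + z)) φ =
          bilinearPullback (.id ℂ A) (unitizationMul w) φ +
            bilinearPullback (.id ℂ A) (unitizationMul z) φ := by
        ext x y; simp [unitizationMul]; ring
      rw [h1, h2, map_add, map_add, hw, hz]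
    | smul a w _ hw =>
      have h1 : bilinearPullback (unitizationMul (a • w)) (.id ℂ A) φ =
          a • bilinearPullback (unitizationMul w) (.id ℂ A) φ := by
        ext x y; simp [unitizationMul]; ring
      have h2 : bilinearPullback (.id ℂ A) (unitizationMul (a • w)) φ =
          a • bilinearPullback (.id ℂ A) (unitizationMul w) φ := by
        ext x y; simp [unitizationMul]; ring
      rw [h1, h2, map_smul, map_smul, hw]
  refine ⟨M, ?_, ?_⟩
  · intro c φ χ ψ hχ hψ
    convert key φ (c : Unitization ℂ A) using 2
    · ext x y
      simp [hχ, unitizationMul_apply]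
    · ext x y
      simp [hψ, unitizationMul_apply, hA c y]
  · intro c f φ hφ
    rw [hM φ, hM₀ c f φ hφ]
    -- Forms f(xyc) are fixed by the averaging, as (wx)(w*y) = xww*y = xy by commutativity; so M
    -- keeps the values of M₀ on them.
    intro w
    ext x y
    change φ (unitizationMul _ x) (unitizationMul _ y) = φ x y
    rw [hφ, hφ]
    congr 2
    refine Unitization.inr_injective (R := ℂ) ?_
    rw [Unitization.inr_mul, Unitization.inr_mul, inr_unitizationMul, inr_unitizationMul, hA' w x,
      mul_assoc, ← mul_assoc (w : Unitization ℂ A), Unitary.mul_star_self_of_mem w.2, one_mul]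

end Commutative

end

theorem theorem2p4 {G : Type u} [Group G] (hG : IsAmenableGroup G)
    {A : Type v} [NonUnitalCStarAlgebra A]
    (hA : (∀ a b : A, a * b = b * a) ∨ FiniteDimensional ℂ A)
    (α : G →* (A ≃⋆ₐ[ℂ] A)) :
    IsAmenableBanachAlgebra.{max u v, w} (TwistedL1 α) := by
  refine TwistedL1.isAmenable hG α ?_
  rcases hA with hA | hA
  · exact exists_isVirtualDiagonal_of_commutative hA
  · exact exists_isVirtualDiagonal_of_finiteDimensional
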